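/- Work with point-free spaces (locales) over the category of sets; write $\Omega L$ for the frame of opens of a locale $L$. For a set $X$, regard $X$ as a discrete space, $\Omega X=\mathcal P(X)$. For a Boolean algebra $B$ let $\operatorname{Spec}B$ be the locale whose frame of opens is the frame $\operatorname{Idl}B$ of ideals of $B$; a locale is Stone if it is isomorphic to some $\operatorname{Spec}A$, $A$ a Boolean algebra. For a locale $W$, a prime filter of $B$ at stage $W$ is a map $\varphi\colon B\to\Omega W$ that is monotone and satisfies $\varphi(1)=\top$, $\varphi(a)\wedge\varphi(b)\le\varphi(a\wedge b)$, $\varphi(0)=\bot$ and $\varphi(a\vee b)\le\varphi(a)\vee\varphi(b)$. Let $X$ be a discrete space and $Y=\operatorname{Spec}B$ a Stone space. Then the exponential $Y^X$, with evaluation map $\mathrm{ev}\colon Y^X\times X\to Y$, exists in the category of locales, and: (1) $Y^X$ is Stone. (2) The points of $Y^X$ are the $X$-indexed families of prime filters of $B$. That is, for every locale $W$ there is a bijection between maps $g\colon W\to Y^X$ and families $(\varphi_x)_{x\in X}$ of prime filters of $B$ at stage $W$, where $\varphi_x(b)$ is the inverse image of the basic open $\mathop{\downarrow}b\in\operatorname{Idl}B$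 along $\mathrm{ev}(g,x)\colon W\to Y$. Likewise the global points of $Y^X$ are in bijection with the families $(F_x)_{x\in X}$ of ordinary prime filters of $B$, where $b\in F_x$ iff the point lies in the inverse image of $\mathop{\downarrow}b$ along $\mathrm{ev}(-,x)$. (3) Let $C$ be the Boolean algebra generated by $X\times B$ subject to the relations, for $x\in X$ and $a,b\in B$, $$(x,a)\le(x,b)\ \text{ if } a\le b,\qquad 1\le(x,1),\qquad (x,a)\wedge(x,b)\le(x,a\wedge b),$$ $$(x,0)\le 0,\qquad (x,a\vee b)\le(x,a)\vee(x,b).$$ For every locale $W$, the prime filters $\psi$ of $C$ at stage $W$ are in bijection with the $X$-indexed families of prime filters of $B$ at stage $W$, via $\varphi_x(b)=\psi(x,b)$; and the ordinary prime filters $F$ of $C$ are in bijection with the $X$-indexed families of ordinary prime filters of $B$, via $b\in F_x\iff(x,b)\in F$. Moreover there is an isomorphism $Y^X\cong\operatorname{Spec}C$ under which, for all $x\in X$ and $b\in B$, the basic open $\mathop{\downarrow}(x,b)$ of $\operatorname{Spec}C$ corresponds to the inverse image of $\mathop{\downarrow}b$ along $\mathrm{ev}(-,x)\colon Y^X\to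 Y$. -/

import Mathlib

open CategoryTheory CategoryTheory.Limits Order

universe u v

/-! ### Exponential objects -/

/-- `ev : E ⨯ X ⟶ Y` exhibits `E` as the exponential `Y ^ X`: for every `W`, each morphism
`W ⨯ X ⟶ Y` is `(g × id) ≫ ev` for exactly one `g : W ⟶ E`. -/
def IsExponential {C : Type v} [Category.{u} C] {X Y E : C} [∀ W : C, HasBinaryProduct W X]
    (ev : E ⨯ X ⟶ Y) : Prop :=
  ∀ (W : C) (f : W ⨯ X ⟶ Y), ∃! g : W ⟶ E, prod.map g (𝟙 X) ≫ ev = f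

/-! ### Point-free spaces as locales -/

namespace PointFree

/-- The inverse image frame homomorphism `Ω M → Ω L` of a map of locales `f : L ⟶ M`. -/
def inv {L M : Locale.{u}} (f : L ⟶ M) : FrameHom M L :=
  f.unop.hom

/-- The map of locales `L ⟶ M` with a given inverse image. -/
def mkMap {L M : Locale.{u}} (φ : FrameHom M L) : L ⟶ M :=
  Quiver.Hom.op (V := Frm.{u}) (Frm.ofHom φ)

/-- The discrete space on a set `X`: its frame of opens is the power set of `X`. -/
def discrete (X : Type u) : Locale.{u} :=
  Locale.of (Set X)

/-- The inverse image of the map constant at `x`: a set `S` is sent to the truth value of `x ∈ S`,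
read in the frame `L`. -/
def constHom {X : Type u} (L : Type u) [Frame L] (x : X) : FrameHom (Set X) L where
  toFun S := ⨆ _ : x ∈ S, ⊤
  map_inf' S T := by
    by_cases hS : x ∈ S <;> by_cases hT : x ∈ T <;> simp [hS, hT]
  map_top' := by simp
  map_sSup' 𝒮 := by
    rw [sSup_image]
    simp only [Set.sSup_eq_sUnion, Set.mem_sUnion]
    rw [iSup_exists]
    simp only [iSup_and]

/-- The map `W ⟶ discrete X` that is constant at the element `x` of `X`. -/
def const {X : Type u} (W : Locale.{u}) (x : X) : W ⟶ discrete X :=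
  mkMap (L := W) (M := discrete X) (constHom W x)

/-! #### Products with a discrete space exist

The frame of opens of `W × X`, for `X` discrete, is the `X`-fold power of the frame of `W`. -/

/-- Inverse image of the first projection `W × X ⟶ W`. -/
def fstHom (X : Type u) (L : Type u) [Frame L] : FrameHom L (X → L) where
  toFun a := fun _ => a
  map_inf' _ _ := rfl
  map_top' := rfl
  map_sSup' s := by
    funext x
    rw [sSup_image]
    simp only [iSup_apply]
    exact sSup_eq_iSup

/-- Inverse image of the second projection `W × X ⟶ X`. -/
def sndHom (X : Type u) (L : Type u) [Frame L] : FrameHom (Set X) (X → L) where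
  toFun S := fun x => constHom L x S
  map_inf' S T := by funext x; exact map_inf (constHom L x) S T
  map_top' := by funext x; exact map_top (constHom L x)
  map_sSup' s := by
    funext x
    rw [map_sSup, sSup_image, sSup_image]
    simp only [iSup_apply]

/-- Inverse image of the pairing `V ⟶ W × X` of two maps. -/
def pairHom {X : Type u} {L M : Type u} [Frame L] [Frame M] (f : FrameHom L M)
    (h : FrameHom (Set X) M) : FrameHom (X → L) M where
  toFun t := ⨆ x, f (t x) ⊓ h {x}
  map_inf' s t := by
    apply le_antisymm
    · refine iSup_le fun x => ?_
      simp only [Pi.inf_apply, map_inf]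
      refine le_inf ?_ ?_
      · exact le_iSup_of_le x (inf_le_inf_right _ inf_le_left)
      · exact le_iSup_of_le x (inf_le_inf_right _ inf_le_right)
    · rw [iSup_inf_iSup]
      refine iSup_le fun p => ?_
      obtain ⟨x, y⟩ := p
      by_cases hxy : x = y
      · subst hxy
        refine le_iSup_of_le x ?_
        simp only [Pi.inf_apply, map_inf]
        exact le_inf (le_inf (inf_le_left.trans inf_le_left) (inf_le_right.trans inf_le_left))
          (inf_le_left.trans inf_le_right)
      · have h0 : h {x} ⊓ h {y} = ⊥ := by
          rw [← map_inf]
          have : ({x} : Set X) ⊓ {y} = ⊥ := by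
            ext z
            simp only [Set.inf_eq_inter, Set.mem_inter_iff, Set.mem_singleton_iff,
              Set.bot_eq_empty, Set.mem_empty_iff_false, iff_false]
            rintro ⟨rfl, h⟩
            exact hxy h
          rw [this, map_bot]
        have : f (s x) ⊓ h {x} ⊓ (f (t y) ⊓ h {y}) ≤ h {x} ⊓ h {y} :=
          inf_le_inf inf_le_right inf_le_right
        exact (this.trans h0.le).trans bot_le
  map_top' := by
    simp only [Pi.top_apply, map_top, top_inf_eq]
    rw [← map_iSup]
    have : (⨆ x : X, ({x} : Set X)) = ⊤ := by ext z; simp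
    rw [this, map_top]
  map_sSup' s := by
    rw [sSup_image]
    simp only [sSup_apply, map_iSup, iSup_inf_eq]
    rw [iSup_comm]
    simp only [iSup_subtype]

theorem pairHom_fst {X : Type u} {L M : Type u} [Frame L] [Frame M] (f : FrameHom L M)
    (h : FrameHom (Set X) M) : (pairHom f h).comp (fstHom X L) = f := by
  ext a
  change (⨆ x, f a ⊓ h {x}) = f a
  rw [← inf_iSup_eq, ← map_iSup]
  have : (⨆ x : X, ({x} : Set X)) = ⊤ := by ext z; simp
  rw [this, map_top, inf_top_eq]

theorem pairHom_snd {X : Type u} {L M : Type u} [Frame L] [Frame M] (f : FrameHom L M)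
    (h : FrameHom (Set X) M) : (pairHom f h).comp (sndHom X L) = h := by
  ext S
  change (⨆ x, f (⨆ _ : x ∈ S, ⊤) ⊓ h {x}) = h S
  have : S = ⨆ x, ⨆ _ : x ∈ S, ({x} : Set X) := by ext z; simp
  conv_rhs => rw [this]
  simp only [map_iSup, map_top]
  refine iSup_congr fun x => ?_
  rw [iSup_inf_eq]
  simp

theorem pairHom_unique {X : Type u} {L M : Type u} [Frame L] [Frame M]
    (k : FrameHom (X → L) M) :
    k = pairHom (k.comp (fstHom X L)) (k.comp (sndHom X L)) := by
  ext t
  change k t = ⨆ x, k (fstHom X L (t x)) ⊓ k (sndHom X L {x})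
  simp only [← map_inf, ← map_iSup]
  congr 1
  funext y
  rw [iSup_apply]
  change t y = ⨆ x, (t x ⊓ ⨆ _ : y ∈ ({x} : Set X), ⊤)
  simp [inf_iSup_eq]

instance hasBinaryProductDiscrete (W : Locale.{u}) (X : Type u) :
    HasBinaryProduct W (discrete X) :=
  HasLimit.mk
    { cone := BinaryFan.mk (P := Locale.of (X → W))
        (mkMap (L := Locale.of (X → W)) (M := W) (fstHom X W))
        (mkMap (L := Locale.of (X → W)) (M := discrete X) (sndHom X W))
      isLimit := BinaryFan.IsLimit.mk _
        (fun {T} f g => mkMap (L := T) (M := Locale.of (X → W)) (pairHom (inv f) (inv g)))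
        (fun {T} f g => congrArg (mkMap (L := T) (M := W)) (pairHom_fst (inv f) (inv g)))
        (fun {T} f g =>
          congrArg (mkMap (L := T) (M := discrete X)) (pairHom_snd (inv f) (inv g)))
        (fun {T} f g m hf hg => by
          subst hf hg
          exact congrArg (mkMap (L := T) (M := Locale.of (X → W))) (pairHom_unique (inv m))) }

/-- Evaluation at a single element `x : X`: the map `E ⟶ Y` obtained from `ev : E × X ⟶ Y` by
fixing the second argument. -/
noncomputable def evAt {X : Type u} {Y E : Locale.{u}} (ev : E ⨯ discrete X ⟶ Y) (x : X) :
    E ⟶ Y :=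
  prod.lift (𝟙 E) (const E x) ≫ ev

/-! #### Stone spaces -/

/-- The ideals of a distributive lattice with bottom form a frame. -/
instance idealFrame (P : Type u) [DistribLattice P] [OrderBot P] : Frame (Ideal P) :=
  .ofMinimalAxioms
    { inf_sSup_le_iSup_inf := fun I s => by
        let J : Ideal P := ⨆ K ∈ s, I ⊓ K
        -- the ideal of all `y` with `x ⊓ y ∈ J` for every `x ∈ I`
        let T : Ideal P :=
          { carrier := {y | ∀ x ∈ I, x ⊓ y ∈ J}
            lower' := fun a b hba ha x hx => J.lower (inf_le_inf_left x hba) (ha x hx)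
            nonempty' := ⟨⊥, fun x _ => by rw [inf_bot_eq]; exact J.bot_mem⟩
            directed' := fun a ha b hb =>
              ⟨a ⊔ b, fun x hx => by
                rw [inf_sup_left]; exact Ideal.sup_mem (ha x hx) (hb x hx),
                le_sup_left, le_sup_right⟩ }
        have hT : sSup s ≤ T := sSup_le fun K hK y hy x hx => by
          have hle : I ⊓ K ≤ J := le_iSup₂_of_le (f := fun K (_ : K ∈ s) => I ⊓ K) K hK le_rfl
          have hxy : x ⊓ y ∈ I ⊓ K := ⟨I.lower inf_le_left hx, K.lower inf_le_right hy⟩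
          exact hle hxy
        intro z hz
        have h := hT hz.2 z hz.1
        rwa [inf_idem] at h }

/-- The spectrum of a Boolean algebra `B`: the space whose frame of opens is the ideal completion
of `B`. -/
def Spec (B : Type u) [BooleanAlgebra B] : Locale.{u} :=
  Locale.of (Ideal B)

/-- The basic (clopen) open of `Spec B` given by `b : B`: "`b` belongs to the prime filter". -/
def basic {B : Type u} [BooleanAlgebra B] (b : B) : Spec B :=
  (Ideal.principal b : Ideal B)

/-- A Stone space is (a space isomorphic to) the spectrum of a Boolean algebra. -/
def IsStone (L : Locale.{u}) : Prop :=
  ∃ (A : Type u) (_ : BooleanAlgebra A), Nonempty (L ≅ Spec A)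

/-- A prime filter of `B` with truth values in a frame `Ω`, i.e. a model in `Ω` of the
propositional geometric theory of prime filters of `B`; `φ b` is the truth value of
"`b` belongs to the filter". If `Ω` is the frame of opens of `W`, this is a prime filter of `B`
at stage `W`. -/
structure PrimeFilterIn (B : Type u) [BooleanAlgebra B] (Ω : Type v) [Frame Ω] where
  φ : B → Ω
  up : ∀ {a b : B}, a ≤ b → φ a ≤ φ b
  top : ⊤ ≤ φ ⊤
  inf : ∀ a b : B, φ a ⊓ φ b ≤ φ (a ⊓ b)
  bot : φ ⊥ ≤ ⊥
  sup : ∀ a b : B, φ (a ⊔ b) ≤ φ a ⊔ φ b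

/-- Ordinary prime filters of a Boolean algebra. -/
abbrev PrimeFilter (B : Type u) [BooleanAlgebra B] : Type u :=
  {F : PFilter B // F.IsPrime}

/-! ### Boolean algebras by generators and relations -/

/-- Boolean words over a set of generators. -/
inductive Word (G : Type u) : Type u
  | gen : G → Word G
  | top : Word G
  | bot : Word G
  | inf : Word G → Word G → Word G
  | sup : Word G → Word G → Word G
  | compl : Word G → Word G

/-- The inequalities between Boolean words that are derivable, by the laws of Boolean algebras,
from the relations `R` (where `R s t` stands for the relation `s ≤ t`). -/
inductive Entails {G : Type u} (R : Word G → Word G → Prop) : Word G → Word G → Prop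
  | rel {s t} : R s t → Entails R s t
  | refl (s) : Entails R s s
  | trans {s t r} : Entails R s t → Entails R t r → Entails R s r
  | le_top (s) : Entails R s .top
  | bot_le (s) : Entails R .bot s
  | inf_le_left (s t) : Entails R (.inf s t) s
  | inf_le_right (s t) : Entails R (.inf s t) t
  | le_inf {s t r} : Entails R s t → Entails R s r → Entails R s (.inf t r)
  | le_sup_left (s t) : Entails R s (.sup s t)
  | le_sup_right (s t) : Entails R t (.sup s t)
  | sup_le {s t r} : Entails R s r → Entails R t r → Entails R (.sup s t) r
  | distrib (s t r) : Entails R (.inf (.sup s t) (.sup s r)) (.sup s (.inf t r))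
  | inf_compl (s) : Entails R (.inf s (.compl s)) .bot
  | sup_compl (s) : Entails R .top (.sup s (.compl s))
  | compl_anti {s t} : Entails R s t → Entails R (.compl t) (.compl s)

/-- Two words are identified when each is derivably below the other. -/
def wordSetoid {G : Type u} (R : Word G → Word G → Prop) : Setoid (Word G) where
  r s t := Entails R s t ∧ Entails R t s
  iseqv :=
    { refl := fun s => ⟨.refl s, .refl s⟩
      symm := fun h => ⟨h.2, h.1⟩
      trans := fun h k => ⟨h.1.trans k.1, k.2.trans h.2⟩ }

/-- The Boolean algebra presented by the generators `G` and the relations `R`. -/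
def Presented {G : Type u} (R : Word G → Word G → Prop) : Type u :=
  Quotient (wordSetoid R)

namespace Presented

variable {G : Type u} (R : Word G → Word G → Prop)

/-- The element of the presented Boolean algebra given by a word. -/
def mk (s : Word G) : Presented R := Quotient.mk (wordSetoid R) s

instance : BooleanAlgebra (Presented R) where
  le := Quotient.lift₂ (Entails R) fun _ _ _ _ h k =>
    propext ⟨fun e => (h.2.trans e).trans k.1, fun e => (h.1.trans e).trans k.2⟩
  le_refl := by rintro ⟨s⟩; exact .refl s
  le_trans := by rintro ⟨s⟩ ⟨t⟩ ⟨r⟩; exact Entails.trans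
  le_antisymm := by rintro ⟨s⟩ ⟨t⟩ h k; exact Quotient.sound ⟨h, k⟩
  inf := Quotient.map₂ .inf fun a b h c d k =>
    ⟨.le_inf ((Entails.inf_le_left a c).trans h.1) ((Entails.inf_le_right a c).trans k.1),
      .le_inf ((Entails.inf_le_left b d).trans h.2) ((Entails.inf_le_right b d).trans k.2)⟩
  sup := Quotient.map₂ .sup fun a b h c d k =>
    ⟨.sup_le (h.1.trans (.le_sup_left b d)) (k.1.trans (.le_sup_right b d)),
      .sup_le (h.2.trans (.le_sup_left a c)) (k.2.trans (.le_sup_right a c))⟩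
  compl := Quotient.map .compl fun _ _ h => ⟨.compl_anti h.2, .compl_anti h.1⟩
  top := mk R .top
  bot := mk R .bot
  le_top := by rintro ⟨s⟩; exact .le_top s
  bot_le := by rintro ⟨s⟩; exact .bot_le s
  inf_le_left := by rintro ⟨s⟩ ⟨t⟩; exact .inf_le_left s t
  inf_le_right := by rintro ⟨s⟩ ⟨t⟩; exact .inf_le_right s t
  le_inf := by rintro ⟨s⟩ ⟨t⟩ ⟨r⟩; exact Entails.le_inf
  le_sup_left := by rintro ⟨s⟩ ⟨t⟩; exact .le_sup_left s t
  le_sup_right := by rintro ⟨s⟩ ⟨t⟩; exact .le_sup_right s t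
  sup_le := by rintro ⟨s⟩ ⟨t⟩ ⟨r⟩; exact Entails.sup_le
  le_sup_inf := by rintro ⟨s⟩ ⟨t⟩ ⟨r⟩; exact .distrib s t r
  inf_compl_le_bot := by rintro ⟨s⟩; exact .inf_compl s
  top_le_sup_compl := by rintro ⟨s⟩; exact .sup_compl s

end Presented

/-- The relations, on the generators `X × B`, saying that for each `x : X` the set of all `b` with
`(x, b)` is a prime filter of `B`. -/
inductive PrimeFilterRel (X B : Type u) [BooleanAlgebra B] : Word (X × B) → Word (X × B) → Prop
  | up (x : X) {a b : B} : a ≤ b → PrimeFilterRel X B (.gen (x, a)) (.gen (x, b))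
  | top (x : X) : PrimeFilterRel X B .top (.gen (x, ⊤))
  | inf (x : X) (a b : B) :
      PrimeFilterRel X B (.inf (.gen (x, a)) (.gen (x, b))) (.gen (x, a ⊓ b))
  | bot (x : X) : PrimeFilterRel X B (.gen (x, ⊥)) .bot
  | sup (x : X) (a b : B) :
      PrimeFilterRel X B (.gen (x, a ⊔ b)) (.sup (.gen (x, a)) (.gen (x, b)))

/-- The Boolean algebra generated by `X × B` subject to the prime filter relations. -/
abbrev PowerAlg (X B : Type u) [BooleanAlgebra B] : Type u :=
  Presented (PrimeFilterRel X B)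

/-- The generator `(x, b)` of `PowerAlg X B`. -/
def PowerAlg.gen {X B : Type u} [BooleanAlgebra B] (x : X) (b : B) : PowerAlg X B :=
  Presented.mk (PrimeFilterRel X B) (.gen (x, b))

end PointFree

/-!
A prime filter of `B` with truth values in a frame `Ω` is the same thing as a lattice homomorphism
`B → Ω`, and two universal properties describe all such things.

* The ideal completion is the free frame on the lattice `B`: a prime filter `φ` extends uniquely
  to the frame homomorphism `I ↦ ⨆ b ∈ I, φ b` on `Ideal B` (`PrimeFilterIn.frameHomEquiv`). Hence
  maps `W ⟶ Spec B` are prime filters of `B` at stage `W`.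
* Each value of a prime filter is complemented in `Ω`, so a family of prime filters evaluates every
  Boolean word over `X × B` in `Ω`, soundly for the laws of Boolean algebras. Hence prime filters
  of `PowerAlg X B` in `Ω` are the `X`-indexed families of prime filters of `B` in `Ω`
  (`PrimeFilterIn.powerEquiv`).

Since `X` is discrete, the frame of `W × X` is the power `X → W`, so a map `W × X ⟶ Spec B` is a
prime filter of `B` in `X → W`, which is an `X`-indexed family of prime filters of `B` in `W`
(`prodEquiv`). Under this correspondence `(g × id) ≫ ev` has as its component at `x` the filter
classified by `g ≫ evAt ev x`. Therefore `ev : E ⨯ discrete X ⟶ Spec B` is an exponential exactly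
when `g ↦ (g ≫ evAt ev x)ₓ` is, at every stage `W`, a bijection from maps `W ⟶ E` to families of
prime filters (`isExponential_iff`); that is, when `E` represents the functor which, by the two
equivalences above, is represented by `Spec (PowerAlg X B)`. Ordinary prime filters are the case
where `Ω` is the frame of truth values `Prop`.
-/

namespace PointFree

/-! ### Prime filters valued in a frame -/

namespace PrimeFilterIn

variable {B : Type u} [BooleanAlgebra B] {Ω : Type v} [Frame Ω]

@[ext]
theorem ext {F G : PrimeFilterIn B Ω} (h : ∀ b, F.φ b = G.φ b) : F = G := by
  cases F
  cases G
  congr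
  exact funext h

variable (F : PrimeFilterIn B Ω)

theorem map_top : F.φ ⊤ = ⊤ := top_le_iff.mp F.top

theorem map_bot : F.φ ⊥ = ⊥ := le_bot_iff.mp F.bot

theorem map_inf (a b : B) : F.φ (a ⊓ b) = F.φ a ⊓ F.φ b :=
  le_antisymm (le_inf (F.up inf_le_left) (F.up inf_le_right)) (F.inf a b)

theorem map_sup (a b : B) : F.φ (a ⊔ b) = F.φ a ⊔ F.φ b :=
  le_antisymm (F.sup a b) (sup_le (F.up le_sup_left) (F.up le_sup_right))

theorem isCompl_map_compl (b : B) : IsCompl (F.φ b) (F.φ bᶜ) :=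
  IsCompl.of_eq (by rw [← F.map_inf, inf_compl_eq_bot, F.map_bot])
    (by rw [← F.map_sup, sup_compl_eq_top, F.map_top])

theorem map_compl (b : B) : F.φ bᶜ = (F.φ b)ᶜ :=
  (F.isCompl_map_compl b).compl_eq.symm

theorem sup_compl_eq_top (b : B) : F.φ b ⊔ (F.φ b)ᶜ = ⊤ := by
  rw [← F.map_compl]
  exact (F.isCompl_map_compl b).sup_eq_top

/-! ### The spectrum classifies prime filters -/

/-- The extension of a prime filter to the ideal completion: the truth value of an ideal is that
of "some element of the ideal belongs to the filter". -/
def toFrameHom : FrameHom (Ideal B) Ω where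
  toFun I := ⨆ b ∈ I, F.φ b
  map_inf' I J := by
    apply le_antisymm
    · exact le_inf (iSup₂_le fun b hb => le_iSup₂_of_le b hb.1 le_rfl)
        (iSup₂_le fun b hb => le_iSup₂_of_le b hb.2 le_rfl)
    · rw [iSup₂_inf_eq]
      refine iSup₂_le fun b hb => ?_
      rw [inf_iSup₂_eq]
      refine iSup₂_le fun c hc => (F.inf b c).trans ?_
      exact le_iSup₂_of_le (f := fun d (_ : d ∈ I ⊓ J) => F.φ d) (b ⊓ c)
        ⟨I.lower inf_le_left hb, J.lower inf_le_right hc⟩ le_rfl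
  map_top' := top_le_iff.mp <| F.top.trans <|
    le_iSup₂_of_le (f := fun d (_ : d ∈ (⊤ : Ideal B)) => F.φ d) ⊤ trivial le_rfl
  map_sSup' S := by
    rw [sSup_image]
    apply le_antisymm
    · -- The elements whose truth value is below the right-hand side form an ideal, and it
      -- contains every member of `S`.
      let K : Ideal B :=
        { carrier := {b | F.φ b ≤ ⨆ I ∈ S, ⨆ b ∈ I, F.φ b}
          lower' := fun a b hba ha => (F.up hba).trans ha
          nonempty' := ⟨⊥, F.bot.trans bot_le⟩
          directed' := fun a ha b hb =>
            ⟨a ⊔ b, (F.sup a b).trans (sup_le ha hb), le_sup_left, le_sup_right⟩ }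
      have hK : sSup S ≤ K := sSup_le fun I hI b hb =>
        le_iSup₂_of_le (f := fun I (_ : I ∈ S) => ⨆ b ∈ I, F.φ b) I hI
          (le_iSup₂_of_le (f := fun b (_ : b ∈ I) => F.φ b) b hb le_rfl)
      exact iSup₂_le fun b hb => hK hb
    · refine iSup₂_le fun I hI => iSup₂_le fun b hb => ?_
      exact le_iSup₂_of_le (f := fun d (_ : d ∈ sSup S) => F.φ d) b (le_sSup hI hb) le_rfl

theorem toFrameHom_principal (b : B) : F.toFrameHom (Ideal.principal b) = F.φ b :=
  le_antisymm (iSup₂_le fun _ hc => F.up hc)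
    (le_iSup₂_of_le (f := fun d (_ : d ∈ Ideal.principal b) => F.φ d) b
      Ideal.mem_principal_self le_rfl)

/-- The restriction of a frame homomorphism on ideals to the principal ideals. -/
def ofFrameHom (h : FrameHom (Ideal B) Ω) : PrimeFilterIn B Ω where
  φ b := h (Ideal.principal b)
  up hab := OrderHomClass.mono h (Ideal.principal_le_iff.mpr hab)
  top := by rw [Ideal.principal_top, TopHomClass.map_top]
  inf a b := by
    rw [← InfHomClass.map_inf]
    exact OrderHomClass.mono h fun c hc => le_inf hc.1 hc.2
  bot := by rw [Ideal.principal_bot, BotHomClass.map_bot]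
  sup a b := by
    rw [← SupHomClass.map_sup]
    exact OrderHomClass.mono h (Ideal.principal_le_iff.mpr
      (Ideal.sup_mem (le_sup_left (a := Ideal.principal a) Ideal.mem_principal_self)
        (le_sup_right (a := Ideal.principal a) Ideal.mem_principal_self)))

/-- Prime filters are the frame homomorphisms from the ideal completion. -/
def frameHomEquiv : FrameHom (Ideal B) Ω ≃ PrimeFilterIn B Ω where
  toFun := ofFrameHom
  invFun := toFrameHom
  left_inv h := by
    ext I
    change (⨆ b ∈ I, h (Ideal.principal b)) = h I
    simp only [← map_iSup]
    congr 1
    exact le_antisymm (iSup₂_le fun b hb => Ideal.principal_le_iff.mpr hb)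
      fun b hb => le_iSup₂ (f := fun b (_ : b ∈ I) => Ideal.principal b) b hb
        Ideal.mem_principal_self
  right_inv F := ext F.toFrameHom_principal

/-- Prime filters with values in a power of `Ω` are families of prime filters with values in
`Ω`. -/
def piEquiv (X : Type u) : PrimeFilterIn B (X → Ω) ≃ (X → PrimeFilterIn B Ω) where
  toFun F x :=
    { φ := fun b => F.φ b x
      up := fun h => F.up h x
      top := F.top x
      inf := fun a b => F.inf a b x
      bot := F.bot x
      sup := fun a b => F.sup a b x }
  invFun F :=
    { φ := fun b x => (F x).φ b
      up := fun h x => (F x).up h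
      top := fun x => (F x).top
      inf := fun a b x => (F x).inf a b
      bot := fun x => (F x).bot
      sup := fun a b x => (F x).sup a b }
  left_inv _ := rfl
  right_inv _ := rfl

/-- Prime filters with truth values in `Prop` are the ordinary ones. -/
def propEquiv : PrimeFilterIn B Prop ≃ PrimeFilter B where
  toFun F :=
    ⟨(IsPFilter.of_def (F := {b | F.φ b}) ⟨⊤, F.top trivial⟩
      (fun a ha b hb => ⟨a ⊓ b, F.inf a b ⟨ha, hb⟩, inf_le_left, inf_le_right⟩)
      (fun h => F.up h)).toPFilter,
      ⟨{ IsLowerSet := fun _ _ hba ha hb => ha (F.up hba hb)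
         Nonempty := ⟨⊥, fun h => F.bot h⟩
         Directed := fun a ha b hb =>
          ⟨a ⊔ b, fun h => (F.sup a b h).elim ha hb, le_sup_left, le_sup_right⟩ }⟩⟩
  invFun F :=
    { φ := fun b => b ∈ F.1
      up := fun h => PFilter.mem_of_le h
      top := fun _ => PFilter.top_mem
      inf := fun _ _ h => PFilter.inf_mem h.1 h.2
      bot := fun h => by
        obtain ⟨a, ha⟩ := F.2.compl_ideal.Nonempty
        exact ha (PFilter.mem_of_le bot_le h)
      sup := fun a b h => by
        by_contra hab
        obtain ⟨c, hc, hac, hbc⟩ := F.2.compl_ideal.Directed a (fun ha => hab (Or.inl ha)) b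
          (fun hb => hab (Or.inr hb))
        exact hc (PFilter.mem_of_le (sup_le hac hbc) h) }
  left_inv _ := rfl
  right_inv _ := rfl

end PrimeFilterIn

/-! ### Prime filters of a presented Boolean algebra -/

section Presented

variable {G : Type u} {Ω : Type v} [Frame Ω]

/-- The value in a frame of a Boolean word, given values of the generators. Complements are read as
pseudocomplements, which are true complements as soon as the generators have complemented
values. -/
def Word.eval (val : G → Ω) : Word G → Ω
  | gen g => val g
  | top => ⊤
  | bot => ⊥
  | inf s t => s.eval val ⊓ t.eval val
  | sup s t => s.eval val ⊔ t.eval val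
  | compl s => (s.eval val)ᶜ

theorem Word.eval_sup_compl {val : G → Ω} (hval : ∀ g, val g ⊔ (val g)ᶜ = ⊤) (s : Word G) :
    s.eval val ⊔ (s.eval val)ᶜ = ⊤ := by
  induction s with
  | gen g => exact hval g
  | top => exact top_sup_eq _
  | bot => simp [Word.eval]
  | inf s t hs ht =>
    simp only [Word.eval]
    rw [sup_inf_right]
    refine top_le_iff.mp (le_inf ?_ ?_)
    · exact hs.symm.le.trans (sup_le_sup_left (compl_anti inf_le_left) _)
    · exact ht.symm.le.trans (sup_le_sup_left (compl_anti inf_le_right) _)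
  | sup s t hs ht =>
    simp only [Word.eval]
    rw [compl_sup, sup_inf_left]
    refine top_le_iff.mp (le_inf ?_ ?_)
    · exact hs.symm.le.trans (sup_le_sup_right le_sup_left _)
    · exact ht.symm.le.trans (sup_le_sup_right le_sup_right _)
  | compl s hs =>
    simp only [Word.eval]
    refine top_le_iff.mp (hs.symm.le.trans ?_)
    rw [sup_comm]
    exact sup_le_sup_left le_compl_compl _

/-- Evaluation in a frame is sound for derivations in Boolean algebra. -/
theorem Entails.eval_le {R : Word G → Word G → Prop} {val : G → Ω}
    (hval : ∀ g, val g ⊔ (val g)ᶜ = ⊤) (hR : ∀ s t, R s t → s.eval val ≤ t.eval val)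
    {s t : Word G} (h : Entails R s t) : s.eval val ≤ t.eval val := by
  induction h with
  | rel h => exact hR _ _ h
  | refl s => exact le_rfl
  | trans _ _ h k => exact h.trans k
  | le_top s => exact _root_.le_top
  | bot_le s => exact _root_.bot_le
  | inf_le_left s t => exact _root_.inf_le_left
  | inf_le_right s t => exact _root_.inf_le_right
  | le_inf _ _ h k => exact _root_.le_inf h k
  | le_sup_left s t => exact _root_.le_sup_left
  | le_sup_right s t => exact _root_.le_sup_right
  | sup_le _ _ h k => exact _root_.sup_le h k
  | distrib s t r => exact (sup_inf_left _ _ _).ge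
  | inf_compl s => exact (inf_compl_self _).le
  | sup_compl s => exact (Word.eval_sup_compl hval s).ge
  | compl_anti _ h => exact _root_.compl_anti h

/-- The prime filter of a presented Boolean algebra determined by complemented values of the
generators that satisfy the relations. -/
def PrimeFilterIn.ofEval {R : Word G → Word G → Prop} (val : G → Ω)
    (hval : ∀ g, val g ⊔ (val g)ᶜ = ⊤) (hR : ∀ s t, R s t → s.eval val ≤ t.eval val) :
    PrimeFilterIn (Presented R) Ω where
  φ := Quotient.lift (Word.eval val) fun _ _ h =>
    le_antisymm (h.1.eval_le hval hR) (h.2.eval_le hval hR)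
  up {a b} := by
    induction a using Quotient.ind
    induction b using Quotient.ind
    exact fun h => Entails.eval_le hval hR h
  top := le_rfl
  inf a b := by
    induction a using Quotient.ind
    induction b using Quotient.ind
    exact le_rfl
  bot := le_rfl
  sup a b := by
    induction a using Quotient.ind
    induction b using Quotient.ind
    exact le_rfl

theorem PrimeFilterIn.map_mk {R : Word G → Word G → Prop} (F : PrimeFilterIn (Presented R) Ω)
    (s : Word G) :
    F.φ (Presented.mk R s) = s.eval fun g => F.φ (Presented.mk R (.gen g)) := by
  induction s with
  | gen g => rfl
  | top => exact F.map_top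
  | bot => exact F.map_bot
  | inf s t hs ht => exact (F.map_inf _ _).trans (congrArg₂ _ hs ht)
  | sup s t hs ht => exact (F.map_sup _ _).trans (congrArg₂ _ hs ht)
  | compl s hs => exact (F.map_compl _).trans (congrArg _ hs)

end Presented

section Power

variable (X B : Type u) [BooleanAlgebra B] (Ω : Type v) [Frame Ω]

/-- Prime filters of `PowerAlg X B` are the `X`-indexed families of prime filters of `B`. -/
def PrimeFilterIn.powerEquiv :
    PrimeFilterIn (PowerAlg X B) Ω ≃ (X → PrimeFilterIn B Ω) where
  toFun F x :=
    { φ := fun b => F.φ (PowerAlg.gen x b)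
      up := fun h => F.up (Entails.rel (.up x h))
      top := F.top.trans (F.up (Entails.rel (.top x)))
      inf := fun a b => (F.inf _ _).trans (F.up (Entails.rel (.inf x a b)))
      bot := (F.up (Entails.rel (.bot x))).trans F.bot
      sup := fun a b => (F.up (Entails.rel (.sup x a b))).trans (F.sup _ _) }
  invFun F := .ofEval (fun p => (F p.1).φ p.2) (fun p => (F p.1).sup_compl_eq_top p.2)
    fun s t h => by
      cases h with
      | up x h => exact (F x).up h
      | top x => exact (F x).top
      | inf x a b => exact (F x).inf a b
      | bot x => exact (F x).bot
      | sup x a b => exact (F x).sup a b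
  left_inv F := by
    ext a
    induction a using Quotient.ind
    exact (F.map_mk _).symm
  right_inv _ := rfl

end Power

/-! ### Maps into a spectrum, and out of a product with a discrete space -/

section Maps

variable {X B : Type u} [BooleanAlgebra B]

/-- Maps into the spectrum of `B` are prime filters of `B`. -/
def specEquiv (W : Locale.{u}) (B : Type u) [BooleanAlgebra B] :
    (W ⟶ Spec B) ≃ PrimeFilterIn B W :=
  Equiv.trans
    { toFun := inv
      invFun := mkMap (L := W) (M := Spec B)
      left_inv := fun _ => rfl
      right_inv := fun _ => rfl }
    (PrimeFilterIn.frameHomEquiv (B := B) (Ω := W))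

theorem comp_constHom {L M : Type u} [Frame L] [Frame M] (f : FrameHom L M) (x : X) :
    f.comp (constHom L x) = constHom M x := by
  ext S
  change f (⨆ _ : x ∈ S, ⊤) = ⨆ _ : x ∈ S, ⊤
  simp only [map_iSup, map_top]

theorem comp_const {W E : Locale.{u}} (g : W ⟶ E) (x : X) : g ≫ const E x = const W x :=
  congrArg (mkMap (L := W) (M := discrete X)) (comp_constHom (inv g) x)

/-- Projection of a power of a frame to one factor. -/
def projHom (L : Type u) [Frame L] (x : X) : FrameHom (X → L) L where
  toFun t := t x
  map_inf' _ _ := rfl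
  map_top' := rfl
  map_sSup' s := by
    rw [sSup_image, sSup_apply, iSup_subtype]

variable (W : Locale.{u}) (X)

/-- The locale whose frame is the `X`-fold power of that of `W`, as a cone over `W` and
`discrete X`. The instance `hasBinaryProductDiscrete` records only that some limit cone exists, so
this explicit one is needed to compute with the product. -/
def powerFan : BinaryFan W (discrete X) :=
  BinaryFan.mk (P := Locale.of (X → W))
    (mkMap (L := Locale.of (X → W)) (M := W) (fstHom X W))
    (mkMap (L := Locale.of (X → W)) (M := discrete X) (sndHom X W))

/-- The frame of the product of `W` with a discrete space is a power of that of `W`. -/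
def powerFanIsLimit : IsLimit (powerFan X W) :=
  BinaryFan.IsLimit.mk _
    (fun {T} f g => mkMap (L := T) (M := Locale.of (X → W)) (pairHom (inv f) (inv g)))
    (fun {T} f g => congrArg (mkMap (L := T) (M := W)) (pairHom_fst (inv f) (inv g)))
    (fun {T} f g => congrArg (mkMap (L := T) (M := discrete X)) (pairHom_snd (inv f) (inv g)))
    (fun {T} f g m hf hg => by
      subst hf hg
      exact congrArg (mkMap (L := T) (M := Locale.of (X → W))) (pairHom_unique (inv m)))

/-- The chosen product of `W` with a discrete space has the `X`-fold power as its frame. -/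
noncomputable def prodIso : (W ⨯ discrete X) ≅ Locale.of (X → W) :=
  (limit.isLimit (pair W (discrete X))).conePointUniqueUpToIso (powerFanIsLimit X W)

variable {X}

/-- The section `W ⟶ W × X` at `x` has the projection at `x` as its inverse image. -/
theorem lift_const_prodIso (x : X) :
    prod.lift (𝟙 W) (const W x) ≫ (prodIso X W).hom =
      mkMap (L := W) (M := Locale.of (X → W)) (projHom W x) := by
  apply BinaryFan.IsLimit.hom_ext (powerFanIsLimit X W)
  · have h : (prodIso X W).hom ≫ (powerFan X W).fst = prod.fst :=
      IsLimit.conePointUniqueUpToIso_hom_comp _ _ _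
    exact (Category.assoc _ _ _).trans ((congrArg _ h).trans (prod.lift_fst (𝟙 W) (const W x)))
  · have h : (prodIso X W).hom ≫ (powerFan X W).snd = prod.snd :=
      IsLimit.conePointUniqueUpToIso_hom_comp _ _ _
    exact (Category.assoc _ _ _).trans ((congrArg _ h).trans (prod.lift_snd (𝟙 W) (const W x)))

/-- Maps from `W × X` to the spectrum of `B` are `X`-indexed families of prime filters of `B` at
stage `W`. -/
noncomputable def prodEquiv (X B : Type u) [BooleanAlgebra B] :
    (W ⨯ discrete X ⟶ Spec B) ≃ (X → PrimeFilterIn B W) :=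
  ((prodIso X W).homCongr (Iso.refl (Spec B))).trans <|
    (specEquiv (Locale.of (X → W)) B).trans (PrimeFilterIn.piEquiv X)

theorem prodEquiv_apply (f : W ⨯ discrete X ⟶ Spec B) (x : X) :
    prodEquiv W X B f x = specEquiv W B (prod.lift (𝟙 W) (const W x) ≫ f) := by
  have h : prod.lift (𝟙 W) (const W x) ≫ f =
      (prod.lift (𝟙 W) (const W x) ≫ (prodIso X W).hom) ≫ ((prodIso X W).inv ≫ f) := by
    simp
  rw [h, lift_const_prodIso]
  ext b
  simp only [prodEquiv, Equiv.trans_apply, Iso.homCongr_apply, Iso.refl_hom, Category.comp_id]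
  rfl

end Maps

/-! ### Exponentials as representing objects -/

section Exponential

variable {X B : Type u} [BooleanAlgebra B]

/-- The family of prime filters at stage `W` classified by a map `W ⟶ E`, for a map `ev` out of
`E × X`. -/
noncomputable def family {E : Locale.{u}} (ev : E ⨯ discrete X ⟶ Spec B) (W : Locale.{u})
    (g : W ⟶ E) (x : X) : PrimeFilterIn B W :=
  specEquiv W B (g ≫ evAt ev x)

theorem prodEquiv_map {E W : Locale.{u}} (ev : E ⨯ discrete X ⟶ Spec B) (g : W ⟶ E) :
    prodEquiv W X B (prod.map g (𝟙 (discrete X)) ≫ ev) = family ev W g := by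
  funext x
  rw [prodEquiv_apply, family, evAt, ← Category.assoc, ← Category.assoc, prod.lift_map,
    prod.comp_lift, comp_const]
  simp

theorem isExponential_iff {E : Locale.{u}} (ev : E ⨯ discrete X ⟶ Spec B) :
    IsExponential ev ↔ ∀ W, Function.Bijective (family ev W) := by
  refine forall_congr' fun W => ?_
  rw [Function.bijective_iff_existsUnique, (prodEquiv W X B).symm.forall_congr_left]
  simp only [Equiv.symm_symm, ← prodEquiv_map, EmbeddingLike.apply_eq_iff_eq]

/-- The evaluation map of the exponential realised as the spectrum of `PowerAlg X B`: at `x` it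
sends the generic prime filter `c ↦ basic c` to its restriction along `b ↦ (x, b)`. -/
noncomputable def powerEv (X B : Type u) [BooleanAlgebra B] :
    Spec (PowerAlg X B) ⨯ discrete X ⟶ Spec B :=
  (prodEquiv (Spec (PowerAlg X B)) X B).symm
    (PrimeFilterIn.powerEquiv X B _ (specEquiv _ _ (𝟙 _)))

theorem family_powerEv (W : Locale.{u}) :
    family (powerEv X B) W =
      (specEquiv W (PowerAlg X B)).trans (PrimeFilterIn.powerEquiv X B W) := by
  funext g x
  have h : specEquiv _ B (evAt (powerEv X B) x) =
      PrimeFilterIn.powerEquiv X B _ (specEquiv _ _ (𝟙 _)) x := by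
    rw [evAt, ← prodEquiv_apply, powerEv, Equiv.apply_symm_apply]
  ext b
  exact congrArg (inv g) (congrArg (fun F => F.φ b) h)

theorem isExponential_powerEv : IsExponential (powerEv X B) := by
  rw [isExponential_iff]
  intro W
  rw [family_powerEv]
  exact Equiv.bijective _

/-- Two objects representing families of prime filters are isomorphic compatibly with the
families. -/
theorem exists_iso_of_bijective_family {E E' : Locale.{u}} {ev : E ⨯ discrete X ⟶ Spec B}
    {ev' : E' ⨯ discrete X ⟶ Spec B} (h : ∀ W, Function.Bijective (family ev W))
    (h' : ∀ W, Function.Bijective (family ev' W)) :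
    ∃ i : E ≅ E', ∀ x, i.hom ≫ evAt ev' x = evAt ev x := by
  obtain ⟨f, hf⟩ := (h' E).2 (family ev E (𝟙 E))
  obtain ⟨g, hg⟩ := (h E').2 (family ev' E' (𝟙 E'))
  have hf' (x : X) : f ≫ evAt ev' x = evAt ev x := by
    simpa using (specEquiv E B).injective (congrFun hf x)
  have hg' (x : X) : g ≫ evAt ev x = evAt ev' x := by
    simpa using (specEquiv E' B).injective (congrFun hg x)
  refine ⟨⟨f, g, (h E).1 ?_, (h' E').1 ?_⟩, hf'⟩ <;> funext x <;> simp [family, hf', hg']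

end Exponential

end PointFree

theorem proposition9p1 (X B : Type u) [BooleanAlgebra B] :
    -- the exponential of `Spec B` by the discrete space `X` exists
    (∃ (E : Locale.{u}) (ev : E ⨯ PointFree.discrete X ⟶ PointFree.Spec B), IsExponential ev) ∧
    ∀ (E : Locale.{u}) (ev : E ⨯ PointFree.discrete X ⟶ PointFree.Spec B), IsExponential ev →
      -- it is Stone
      PointFree.IsStone E ∧
      -- its points, at every stage `W`, are the `X`-indexed families of prime filters of `B`
      (∀ W : Locale.{u}, ∃ Φ : (W ⟶ E) ≃ (X → PointFree.PrimeFilterIn B W), ∀ g x b,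
        (Φ g x).φ b = PointFree.inv (g ≫ PointFree.evAt ev x) (PointFree.basic b)) ∧
      -- the same for global points and ordinary prime filters
      (∃ Φ : Locale.PT E ≃ (X → PointFree.PrimeFilter B), ∀ p x b,
        b ∈ (Φ p x).1 ↔ p (PointFree.inv (PointFree.evAt ev x) (PointFree.basic b))) ∧
      -- such families correspond to prime filters of the algebra generated by `X × B`,
      -- at every stage and for ordinary prime filters
      (∀ W : Locale.{u}, ∃ Ψ : PointFree.PrimeFilterIn (PointFree.PowerAlg X B) W ≃
          (X → PointFree.PrimeFilterIn B W), ∀ F x b,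
        (Ψ F x).φ b = F.φ (PointFree.PowerAlg.gen x b)) ∧
      (∃ Ψ : PointFree.PrimeFilter (PointFree.PowerAlg X B) ≃ (X → PointFree.PrimeFilter B),
        ∀ F x b, b ∈ (Ψ F x).1 ↔ PointFree.PowerAlg.gen x b ∈ F.1) ∧
      -- so the exponential is the spectrum of that algebra, compatibly with evaluation
      (∃ i : E ≅ PointFree.Spec (PointFree.PowerAlg X B), ∀ x b,
        PointFree.inv i.hom (PointFree.basic (PointFree.PowerAlg.gen x b)) =
          PointFree.inv (PointFree.evAt ev x) (PointFree.basic b)) := by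
  refine ⟨⟨_, _, PointFree.isExponential_powerEv⟩, fun E ev hev => ?_⟩
  have hfam := (PointFree.isExponential_iff ev).mp hev
  obtain ⟨i, hi⟩ := PointFree.exists_iso_of_bijective_family hfam
    ((PointFree.isExponential_iff (PointFree.powerEv X B)).mp PointFree.isExponential_powerEv)
  have hbasic (x : X) (b : B) :
      PointFree.inv i.hom (PointFree.basic (PointFree.PowerAlg.gen x b)) =
        PointFree.inv (PointFree.evAt ev x) (PointFree.basic b) := by
    have h := congrFun (congrFun (PointFree.family_powerEv E) i.hom) x
    rw [PointFree.family, hi] at h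
    exact (congrArg (fun F => F.φ b) h).symm
  let Ψ : PointFree.PrimeFilter (PointFree.PowerAlg X B) ≃ (X → PointFree.PrimeFilter B) :=
    PointFree.PrimeFilterIn.propEquiv.symm.trans
      ((PointFree.PrimeFilterIn.powerEquiv X B Prop).trans
        (Equiv.piCongrRight fun _ => PointFree.PrimeFilterIn.propEquiv))
  -- `Prop` is not the frame of a stage in universe `u`, so the bijections `family ev W` do not cover
  -- global points; these are transported to `Spec (PowerAlg X B)` along `i` instead.
  let points : Locale.PT E ≃ Locale.PT (PointFree.Spec (PointFree.PowerAlg X B)) :=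
    { toFun := fun p => p.comp (PointFree.inv i.hom)
      invFun := fun q => q.comp (PointFree.inv i.inv)
      left_inv := fun p => congrArg (fun k : E ⟶ E => p.comp (PointFree.inv k)) i.hom_inv_id
      right_inv := fun q => congrArg
        (fun k : PointFree.Spec (PointFree.PowerAlg X B) ⟶
            PointFree.Spec (PointFree.PowerAlg X B) =>
          q.comp (PointFree.inv k)) i.inv_hom_id }
  refine ⟨⟨_, inferInstance, ⟨i⟩⟩, fun W => ⟨Equiv.ofBijective _ (hfam W), fun g x b => rfl⟩,
    ⟨points.trans (PointFree.PrimeFilterIn.frameHomEquiv.trans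
      (PointFree.PrimeFilterIn.propEquiv.trans Ψ)), fun p x b => ?_⟩,
    fun W => ⟨PointFree.PrimeFilterIn.powerEquiv X B W, fun F x b => rfl⟩,
    ⟨Ψ, fun F x b => Iff.rfl⟩, ⟨i, hbasic⟩⟩
  rw [← hbasic]
  rfl
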